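/- All monoids are commutative, written additively. For a monoid $M$ let $M^*$ be its group of units, $\lambda : M\to M^{gp}$ the canonical map to its Grothendieck group, and $\overline M = M/M^*$ (two elements $q,q'$ are identified iff $q+u=q'+u'$ for some $u,u'\in M^*$). An ideal of $M$ is a subset $I$ (possibly empty) with $I+M\subseteq I$; it is prime if $I\ne M$ and $q+k\in I$ implies $q\in I$ or $k\in I$. The height of a prime ideal $\mathfrak p$ is the maximal length $h$ of a chain of prime ideals $\mathfrak p_h\subsetneq\dots\subsetneq\mathfrak p_0=\mathfrak p$. A homomorphism $\theta:P\to M$ is local if $\theta^{-1}(M^*)=P^*$, and exact if the square formed by $\theta$, $\theta^{gp}$ and the canonical maps $P\to P^{gp}$, $M\to M^{gp}$ is cartesian. A monoid $M$ is fine if it is cancellative and finitely generated, and saturated if it is cancellative and every $x\in M^{gp}$ with $mx\in M$ for some integer $m>0$ lies in $M$. **Proposition.** Let $Q$ be a fine monoid. The set of prime ideals of $Q$ of height one is finite, and for each such $\mathfrak p$ there is a unique epimorphism $v_{\mathfrak p}:Q^{gp}\to\mathbb Z$ such that, for all $q\in Q$, $v_{\mathfrak p}(q)>0$ if and only if $q\in\mathfrak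 p$. Let $W_Q^+$ be the free (commutative) monoid on the set of prime ideals of height one. Then $$v(q)=\sum_{ht(\mathfrak p)=1} v_{\mathfrak p}(q)\,\mathfrak p$$ lies in $W_Q^+$ for every $q\in Q$ and defines a homomorphism of monoids $v:Q\to W_Q^+$, which is local. For $q_1,q_2\in Q$ one has $v(q_1)=v(q_2)$ if and only if there is an integer $n>0$ with $n\overline{q_1}=n\overline{q_2}$ in $\overline Q$. Moreover $v$ is exact if and only if $Q$ is saturated. -/

import Mathlib

open Algebra

namespace CommMonoidGeometry

variable {P Q : Type*} [AddCommMonoid P] [AddCommMonoid Q]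

/-- An ideal `I` of a commutative monoid is prime if it is not the whole monoid and
`q + k ∈ I` implies `q ∈ I` or `k ∈ I`. The empty ideal is prime. -/
structure IsPrimeIdeal (I : AddSemigroupIdeal Q) : Prop where
  ne_univ : (I : Set Q) ≠ Set.univ
  mem_or_mem : ∀ {q k : Q}, q + k ∈ I → q ∈ I ∨ k ∈ I

variable (Q) in
/-- The spectrum of a commutative monoid: its prime ideals, ordered by inclusion. -/
abbrev MonoidSpec : Type _ := {I : AddSemigroupIdeal Q // IsPrimeIdeal I}

variable (Q) in
/-- The prime ideals of height one, where the height of `𝔭` is the supremum of the lengths of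
strict chains of prime ideals ending at `𝔭`. -/
abbrev HeightOnePrime : Type _ := {p : MonoidSpec Q // Order.height p = 1}

/-- `w : Q^gp → ℤ` is an epimorphism with `w⁻¹(ℕ⁺) ∩ Q = 𝔭`. -/
structure IsValuationAt (p : HeightOnePrime Q) (w : GrothendieckAddGroup Q →+ ℤ) : Prop where
  surjective : Function.Surjective w
  pos_iff : ∀ q : Q, 0 < w (GrothendieckAddGroup.of q) ↔ q ∈ p.1.1

/-- The valuation `v_𝔭 : Q^gp → ℤ` attached to a prime ideal `𝔭` of height one: the epimorphism
with `v_𝔭⁻¹(ℕ⁺) ∩ Q = 𝔭`. (Its existence and uniqueness for fine `Q` has to be proved.) -/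
noncomputable def valuation (p : HeightOnePrime Q) : GrothendieckAddGroup Q →+ ℤ :=
  Classical.epsilon (IsValuationAt p)

/-- A homomorphism is local if the preimage of the group of units is the group of units. -/
def IsLocal (θ : P →+ Q) : Prop :=
  θ ⁻¹' {q : Q | IsAddUnit q} = {p : P | IsAddUnit p}

/-- The homomorphism `θ^gp : P^gp → Q^gp` induced by `θ`. -/
noncomputable def gpMap (θ : P →+ Q) : GrothendieckAddGroup P →+ GrothendieckAddGroup Q :=
  GrothendieckAddGroup.lift (GrothendieckAddGroup.of.comp θ)

/-- A homomorphism `θ : P → Q` is exact if the square formed by `θ`, `θ^gp` and the canonical maps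
`P → P^gp`, `Q → Q^gp` is cartesian. -/
def IsExact (θ : P →+ Q) : Prop :=
  ∀ (q : Q) (x : GrothendieckAddGroup P), GrothendieckAddGroup.of q = gpMap θ x →
    ∃! p : P, θ p = q ∧ GrothendieckAddGroup.of p = x

variable (Q) in
/-- A monoid `Q` is saturated if it is integral (cancellative) and every `x ∈ Q^gp` with
`m x ∈ Q` for some positive integer `m` lies in `Q`. -/
structure IsSaturated : Prop where
  integral : IsCancelAdd Q
  mem_of_nsmul_mem : ∀ (x : GrothendieckAddGroup Q) (m : ℕ), 0 < m →
    m • x ∈ Set.range (GrothendieckAddGroup.of (M := Q)) →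
    x ∈ Set.range (GrothendieckAddGroup.of (M := Q))

/-- The congruence defining the quotient `Q / S` by a submonoid `S`: `q ~ q'` if and only if
`q + s = q' + s'` for some `s, s' ∈ S`. -/
def quotientCon (S : AddSubmonoid Q) : AddCon Q where
  r q q' := ∃ s ∈ S, ∃ s' ∈ S, q + s = q' + s'
  iseqv :=
    { refl := fun _ => ⟨0, S.zero_mem, 0, S.zero_mem, rfl⟩
      symm := by
        rintro _ _ ⟨s, hs, s', hs', h⟩
        exact ⟨s', hs', s, hs, h.symm⟩
      trans := by
        rintro a b c ⟨s, hs, s', hs', h⟩ ⟨t, ht, t', ht', h'⟩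
        refine ⟨s + t, S.add_mem hs ht, t' + s', S.add_mem ht' hs', ?_⟩
        rw [← add_assoc, h, add_right_comm, h', add_assoc] }
  add' := by
    rintro a b c d ⟨s, hs, s', hs', h⟩ ⟨t, ht, t', ht', h'⟩
    refine ⟨s + t, S.add_mem hs ht, s' + t', S.add_mem hs' ht', ?_⟩
    rw [add_add_add_comm, h, h', add_add_add_comm]

variable (Q) in
/-- The quotient `Q̄ = Q / Q*` of `Q` by its group of units. -/
abbrev SharpQuotient : Type _ := (quotientCon (IsAddUnit.addSubmonoid Q)).Quotient

variable (Q) in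
/-- The canonical projection `Q → Q̄`. -/
def toSharpQuotient : Q →+ SharpQuotient Q := (quotientCon (IsAddUnit.addSubmonoid Q)).mk'

end CommMonoidGeometry

/-! The complement of a prime ideal is a face of `Q`. Since the empty ideal is prime, height one
means minimal nonempty, so these primes are the complements of the facets of the cone spanned by
`Q`, and v_𝔭 is the primitive inner normal of the facet.

The engine is an integral Farkas lemma in which the separating functional is normal to a facet
(`exists_facet_neg`), applied to localizations of `Q` at faces (`exists_facet_at_prime`). It shows
that every height-one prime is the positivity locus of a facet functional, unique up to scaling, and
that an element of Q^gp nonnegative under all v_𝔭 has a positive multiple in `Q`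
(`exists_nsmul_mem_range_of_valuation_nonneg`). Applied to -q, to q₁ - q₂ and to a general x, the
latter gives the main direction of locality, of the description of the fibres of v, and of
exactness. -/

namespace CommMonoidGeometry

/-! ### Integral Farkas lemma and facet functionals. -/

section Farkas

variable {G : Type*} [AddCommGroup G]

/-- An element of infinite order in a finitely generated abelian group is detected by an integral
functional. -/
theorem exists_hom_neg [AddGroup.FG G] {x : G} (hx : ∀ n : ℕ, 0 < n → n • x ≠ 0) :
    ∃ w : G →+ ℤ, w x < 0 := by
  have : Module.Finite ℤ G := Module.Finite.iff_addGroup_fg.2 inferInstance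
  let π := (Submodule.torsion ℤ G).mkQ
  have hπ : π x ≠ 0 := by
    intro h
    rw [Submodule.mkQ_apply, Submodule.Quotient.mk_eq_zero, Submodule.mem_torsion_iff] at h
    obtain ⟨a, ha⟩ := h
    have ha0 : (a : ℤ) ≠ 0 := nonZeroDivisors.coe_ne_zero a
    refine hx (a : ℤ).natAbs (Int.natAbs_pos.2 ha0) ?_
    have h1 : (a : ℤ) • x = 0 := ha
    rcases Int.natAbs_eq (a : ℤ) with h | h
    · rw [h, natCast_zsmul] at h1
      exact h1
    · rw [h, neg_smul, natCast_zsmul, neg_eq_zero] at h1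
      exact h1
  obtain ⟨f, hf⟩ := Module.Projective.exists_dual_ne_zero ℤ hπ
  let w : G →+ ℤ := (f.comp π).toAddMonoidHom
  have hw : w x ≠ 0 := hf
  rcases lt_or_gt_of_ne hw with h | h
  · exact ⟨w, h⟩
  · exact ⟨-w, by simpa using h⟩

/-- Farkas' lemma over the integers. -/
theorem exists_nonneg_neg [AddGroup.FG G] (T : Finset G) {x : G}
    (hx : ∀ n : ℕ, 0 < n → n • x ∉ AddSubmonoid.closure (T : Set G)) :
    ∃ w : G →+ ℤ, (∀ g ∈ T, 0 ≤ w g) ∧ w x < 0 := by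
  classical
  suffices h : ∀ (k : ℕ) (T : Finset G), T.card ≤ k → ∀ {x : G},
      (∀ n : ℕ, 0 < n → n • x ∉ AddSubmonoid.closure (T : Set G)) →
      ∃ w : G →+ ℤ, (∀ g ∈ T, 0 ≤ w g) ∧ w x < 0 from h _ T le_rfl hx
  intro k
  induction k with
  | zero =>
    intro T hk x hx
    obtain rfl := Finset.card_eq_zero.1 (Nat.le_zero.1 hk)
    obtain ⟨w, hw⟩ := exists_hom_neg (x := x) fun n hn h => hx n hn (by simp [h])
    exact ⟨w, by simp, hw⟩
  | succ k ih =>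
    intro T hk x hx
    rcases T.eq_empty_or_nonempty with rfl | ⟨a, ha⟩
    · exact ih ∅ (by simp) hx
    obtain ⟨T', haT', rfl⟩ : ∃ T', a ∉ T' ∧ insert a T' = T :=
      ⟨T.erase a, by simp, Finset.insert_erase ha⟩
    rw [Finset.card_insert_of_notMem haT', Nat.add_le_add_iff_right] at hk
    set S := AddSubmonoid.closure ((insert a T' : Finset G) : Set G) with hS
    have hgS : ∀ g ∈ insert a T', g ∈ S := fun g hg => AddSubmonoid.subset_closure hg
    have haS : a ∈ S := hgS a ha
    obtain ⟨w, hw, hwx⟩ := ih T' hk (x := x) fun n hn h =>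
      hx n hn (AddSubmonoid.closure_mono (by simp) h)
    rcases le_or_gt 0 (w a) with hwa | hwa
    · exact ⟨w, by simpa [hwa] using hw, hwx⟩
    obtain ⟨c, hc⟩ := Int.eq_ofNat_of_zero_le (a := -w a) (by lia)
    obtain ⟨d, hd⟩ := Int.eq_ofNat_of_zero_le (a := -w x) (by lia)
    have hc0 : 0 < c := by lia
    -- Fourier–Motzkin elimination: π kills `a` and sends `T'` into the monoid `S`, because `w` is
    -- nonnegative on `T'`. A functional found for `π x` and the image of `T'` then pulls back along
    -- π.
    let π : G →+ G := ((zmultiplesHom G a).comp w) + c • AddMonoidHom.id G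
    have hπ : ∀ y, π y = w y • a + c • y := fun y => rfl
    have key : AddSubmonoid.closure ((T'.image π : Finset G) : Set G) ≤ S := by
      refine AddSubmonoid.closure_le.2 fun z hz => ?_
      simp only [Finset.coe_image, Set.mem_image, Finset.mem_coe] at hz
      obtain ⟨g, hg, rfl⟩ := hz
      obtain ⟨m, hm⟩ := Int.eq_ofNat_of_zero_le (hw g hg)
      rw [SetLike.mem_coe, hπ, hm, natCast_zsmul]
      exact add_mem (nsmul_mem haS m) (nsmul_mem (hgS g (Finset.mem_insert_of_mem hg)) c)
    obtain ⟨u, hu, hux⟩ := ih (T'.image π) (Finset.card_image_le.trans hk) (x := π x) fun n hn h => by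
      -- As π x = c x - d a, adding n d copies of `a` to n π x leaves n c x in `S`.
      refine hx (n * c) (Nat.mul_pos hn hc0) ?_
      have h1 := add_mem (key h) (nsmul_mem haS (n * d))
      have h2 : n • π x + (n * d) • a = (n * c) • x := by
        have h3 : w x = -(d : ℤ) := by lia
        rw [hπ, h3, neg_smul, natCast_zsmul, mul_smul, mul_smul, ← smul_add]
        congr 1
        abel
      rwa [h2] at h1
    refine ⟨u.comp π, fun g hg => ?_, hux⟩
    rcases Finset.mem_insert.1 hg with rfl | hg
    · have : π g = 0 := by
        have h3 : w g = -(c : ℤ) := by lia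
        rw [hπ, h3, neg_smul, natCast_zsmul, neg_add_cancel]
      simp [this]
    · exact hu _ (Finset.mem_image_of_mem π hg)

/-- Farkas' lemma with a facet: the separating functional can be chosen such that every functional
vanishing on the generators where it vanishes is proportional to it. -/
theorem exists_facet_neg [AddGroup.FG G] (T : Finset G)
    (hT : AddSubgroup.closure (T : Set G) = ⊤) {x : G}
    (hx : ∀ n : ℕ, 0 < n → n • x ∉ AddSubmonoid.closure (T : Set G)) :
    ∃ w : G →+ ℤ, (∀ g ∈ T, 0 ≤ w g) ∧ w x < 0 ∧
      ∀ u : G →+ ℤ, (∀ g ∈ T, w g = 0 → u g = 0) → ∀ y, w x * u y = u x * w y := by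
  classical
  let Z : (G →+ ℤ) → Finset G := fun w => {g ∈ T | w g = 0}
  let A : Set (G →+ ℤ) := {w | (∀ g ∈ T, 0 ≤ w g) ∧ w x < 0}
  -- Among separating functionals, take one vanishing on as many generators as possible.
  obtain ⟨w, ⟨hw, hwx⟩, hmax⟩ : ∃ w ∈ A, ∀ w' ∈ A, (Z w').card ≤ (Z w).card := by
    have hfin : ((fun w => (Z w).card) '' A).Finite :=
      (Set.finite_Iic T.card).subset (by
        rintro _ ⟨w, -, rfl⟩
        exact Finset.card_filter_le _ _)
    obtain ⟨w₀, hw₀⟩ := exists_nonneg_neg T hx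
    obtain ⟨_, ⟨⟨w, hw, rfl⟩, h⟩⟩ := hfin.exists_maximal ⟨_, w₀, hw₀, rfl⟩
    refine ⟨w, hw, fun w' hw' => ?_⟩
    by_contra! hlt
    exact absurd (h ⟨w', hw', rfl⟩ hlt.le) (not_le.2 hlt)
  refine ⟨w, hw, hwx, ?_⟩
  have noneg : ∀ u : G →+ ℤ, (∀ g ∈ T, w g = 0 → u g = 0) → u x = 0 → ∀ g ∈ T, 0 ≤ u g := by
    intro u hu hux
    by_contra! hneg
    obtain ⟨g₁, hg₁, hug₁⟩ := hneg
    -- Ratio test: move `w` in the direction `u` until the first generator with `u` negative reaches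
    -- zero. The result still separates but has a larger zero set, against maximality.
    obtain ⟨g₀, hg₀, hmin⟩ := Finset.exists_min_image {g ∈ T | u g < 0}
      (fun g => (w g : ℚ) / (-u g : ℚ)) ⟨g₁, by simp [hg₁, hug₁]⟩
    rw [Finset.mem_filter] at hg₀
    obtain ⟨hg₀, hug₀⟩ := hg₀
    let w' : G →+ ℤ := (-u g₀) • w + w g₀ • u
    have hw'_apply : ∀ y, w' y = -u g₀ * w y + w g₀ * u y := fun y => rfl
    have hw' : w' ∈ A := by
      refine ⟨fun g hg => ?_, ?_⟩
      · rw [hw'_apply]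
        rcases le_or_gt 0 (u g) with h | h
        · exact add_nonneg (mul_nonneg (by lia) (hw g hg)) (mul_nonneg (hw g₀ hg₀) h)
        · have h1 := hmin g (by simp [hg, h])
          have h2 : (0 : ℚ) < -u g := by exact_mod_cast neg_pos.2 h
          have h3 : (0 : ℚ) < -u g₀ := by exact_mod_cast neg_pos.2 hug₀
          rw [div_le_div_iff₀ h3 h2] at h1
          have h4 : w g₀ * -u g ≤ w g * -u g₀ := by exact_mod_cast h1
          linarith
      · rw [hw'_apply, hux, mul_zero, add_zero]
        exact mul_neg_of_pos_of_neg (by lia) hwx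
    refine absurd (hmax w' hw') (not_le.2 (Finset.card_lt_card ?_))
    refine Finset.ssubset_iff_of_subset (fun g hg => ?_) |>.2 ⟨g₀, ?_, ?_⟩
    · simp only [Z, Finset.mem_filter] at hg ⊢
      exact ⟨hg.1, by rw [hw'_apply, hg.2, hu g hg.1 hg.2]; simp⟩
    · simp only [Z, Finset.mem_filter]
      exact ⟨hg₀, by rw [hw'_apply]; ring⟩
    · simp only [Z, Finset.mem_filter, not_and]
      exact fun _ h => hug₀.ne (hu g₀ hg₀ h)
  intro u hu y
  -- This combination vanishes at `x`, so the sign claim applies to both `u'` and `-u'`.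
  let u' : G →+ ℤ := w x • u - u x • w
  have hu'_apply : ∀ y, u' y = w x * u y - u x * w y := fun y => rfl
  have hu' : ∀ g ∈ T, w g = 0 → u' g = 0 := fun g hg h => by
    rw [hu'_apply, h, hu g hg h]; simp
  have hu'x : u' x = 0 := by rw [hu'_apply]; ring
  have hz : u' = 0 := by
    refine AddMonoidHom.eq_of_eqOn_dense hT fun g hg => ?_
    have h1 := noneg u' hu' hu'x g hg
    have h2 := noneg (-u') (fun g hg h => by simp [hu' g hg h]) (by simp [hu'x]) g hg
    rw [AddMonoidHom.neg_apply] at h2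
    rw [AddMonoidHom.zero_apply]
    lia
  have := DFunLike.congr_fun hz y
  rw [hu'_apply, AddMonoidHom.zero_apply] at this
  lia

/-- A nonzero integral functional is a positive multiple of a surjective one. -/
theorem exists_surjective_of_ne_zero {w : G →+ ℤ} (hw : w ≠ 0) :
    ∃ (w' : G →+ ℤ) (d : ℤ), 0 < d ∧ Function.Surjective w' ∧ ∀ y, w y = d * w' y := by
  obtain ⟨a, ha⟩ := Int.subgroup_cyclic w.range
  have hmem : ∀ z, z ∈ w.range ↔ a ∣ z := fun z => by
    rw [ha, ← Int.mem_zmultiples_iff, AddSubgroup.zmultiples_eq_closure]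
  have ha0 : a ≠ 0 := by
    rintro rfl
    refine hw (AddMonoidHom.ext fun y => ?_)
    simpa using (hmem (w y)).1 ⟨y, rfl⟩
  have hdvd : ∀ y, |a| ∣ w y := fun y => (abs_dvd _ _).2 ((hmem _).1 ⟨y, rfl⟩)
  have hpos : 0 < |a| := abs_pos.2 ha0
  have hdiv : ∀ y, w y = |a| * (w y / |a|) := fun y => (Int.mul_ediv_cancel' (hdvd y)).symm
  refine ⟨AddMonoidHom.mk' (fun y => w y / |a|) fun y z => ?_, |a|, hpos, fun z => ?_, hdiv⟩
  · rw [map_add, Int.add_ediv_of_dvd_left (hdvd y)]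
  · obtain ⟨y, hy⟩ := (hmem (|a| * z)).2 ((dvd_abs a a).2 dvd_rfl |>.mul_right z)
    exact ⟨y, by
      rw [AddMonoidHom.mk'_apply, hy, Int.mul_ediv_cancel_left _ hpos.ne']⟩

end Farkas

/-! ### Prime ideals of height one as facets. -/

section Facets

open GrothendieckAddGroup (of)

variable {Q : Type*} [AddCommMonoid Q]

theorem exists_eq_of_sub_of (x : GrothendieckAddGroup Q) : ∃ a b : Q, x = of a - of b := by
  obtain ⟨⟨a, b⟩, h⟩ := (AddLocalization.addMonoidOf (⊤ : AddSubmonoid Q)).surj x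
  exact ⟨a, b, eq_sub_of_add_eq h⟩

instance grothendieckAddGroup_fg [AddMonoid.FG Q] : AddGroup.FG (GrothendieckAddGroup Q) :=
  AddGroup.fg_iff_addMonoid_fg.2 inferInstance

theorem IsPrimeIdeal.add_mem {I : AddSemigroupIdeal Q} (q : Q) {k : Q} (hk : k ∈ I) : q + k ∈ I :=
  AddSemigroupIdeal.add_mem I q hk

theorem IsPrimeIdeal.add_mem' {I : AddSemigroupIdeal Q} {q : Q} (k : Q) (hq : q ∈ I) :
    q + k ∈ I :=
  add_comm k q ▸ AddSemigroupIdeal.add_mem I k hq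

theorem IsPrimeIdeal.zero_notMem {I : AddSemigroupIdeal Q} (hI : IsPrimeIdeal I) :
    (0 : Q) ∉ I := fun h =>
  hI.ne_univ (Set.eq_univ_of_forall fun q => by simpa using IsPrimeIdeal.add_mem q h)

variable (Q) in
/-- The empty prime ideal. -/
def emptyPrime : MonoidSpec Q :=
  ⟨⊥, ⟨fun h => (h ▸ Set.mem_univ (0 : Q) : (0 : Q) ∈ ((⊥ : AddSemigroupIdeal Q) : Set Q)),
    fun h => (Set.notMem_empty _ h).elim⟩⟩

variable (Q) in
/-- The prime ideal of the elements that are not units. -/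
def nonunitPrime : MonoidSpec Q :=
  ⟨{ carrier := {q | ¬IsAddUnit q}
     vadd_mem' := fun _ _ hx h => hx (isAddUnit_of_add_isAddUnit_right h) },
    ⟨fun h => (h.ge (Set.mem_univ (0 : Q)) : ¬IsAddUnit (0 : Q)) isAddUnit_zero,
      fun {q k} h => not_and_or.1 fun hqk => (h : ¬IsAddUnit (q + k)) (hqk.1.add hqk.2)⟩⟩

theorem mem_nonunitPrime {q : Q} : q ∈ (nonunitPrime Q).1 ↔ ¬IsAddUnit q :=
  Iff.rfl

theorem isMin_iff_forall_notMem (p : MonoidSpec Q) : IsMin p ↔ ∀ q, q ∉ p.1 :=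
  ⟨fun h _ hq => Set.notMem_empty _ (h (fun _ hr => (Set.notMem_empty _ hr).elim :
    emptyPrime Q ≤ p) hq), fun h _ _ q hq => (h q hq).elim⟩

/-- The empty prime is the least one, so height zero means empty and height one means minimal among
the nonempty primes. -/
theorem height_eq_one_iff (p : MonoidSpec Q) :
    Order.height p = 1 ↔ (∃ q, q ∈ p.1) ∧
      ∀ p' : MonoidSpec Q, (∃ q, q ∈ p'.1) → p' ≤ p → p' = p := by
  have h1 : Order.height p = 1 ↔ ¬IsMin p ∧ Order.height p ≤ (1 : ℕ) := by
    rw [← Order.height_eq_zero, Nat.cast_one, ← Ne, ← Order.one_le_iff_ne_zero,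
      le_antisymm_iff, and_comm]
  rw [h1, Order.height_le_coe_iff, isMin_iff_forall_notMem]
  simp only [Nat.cast_one, Order.lt_one_iff, Order.height_eq_zero, isMin_iff_forall_notMem]
  refine and_congr (by push Not; rfl) (forall_congr' fun p' => ?_)
  rw [lt_iff_le_and_ne]
  constructor
  · rintro h ⟨q, hq⟩ hle
    by_contra hne
    exact h ⟨hle, hne⟩ q hq
  · rintro h ⟨hle, hne⟩ q hq
    exact hne (h ⟨q, hq⟩ hle)

theorem closure_image_of {T : Finset Q} [DecidableEq (GrothendieckAddGroup Q)]
    (hT : AddSubmonoid.closure (T : Set Q) = ⊤) :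
    AddSubgroup.closure
      ((T.image of : Finset (GrothendieckAddGroup Q)) : Set (GrothendieckAddGroup Q)) = ⊤ := by
  have h : ∀ q : Q, of q ∈ AddSubgroup.closure
      ((T.image of : Finset (GrothendieckAddGroup Q)) : Set (GrothendieckAddGroup Q)) := by
    intro q
    have hq : q ∈ AddSubmonoid.closure (T : Set Q) := hT ▸ AddSubmonoid.mem_top q
    induction hq using AddSubmonoid.closure_induction with
    | mem t ht => exact AddSubgroup.subset_closure (by simpa using ⟨t, ht, rfl⟩)
    | zero => rw [map_zero]; exact zero_mem _
    | add a b _ _ ha hb => rw [map_add]; exact add_mem ha hb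
  refine eq_top_iff.2 fun x _ => ?_
  obtain ⟨a, b, rfl⟩ := exists_eq_of_sub_of x
  exact sub_mem (h a) (h b)

/-- A facet functional of `Q`: a nonzero functional which is nonnegative on `Q` and to which
every functional that vanishes on its zero set in `Q` is proportional. -/
structure IsFacetFunctional (w : GrothendieckAddGroup Q →+ ℤ) : Prop where
  nonneg : ∀ q : Q, 0 ≤ w (of q)
  exists_pos : ∃ q : Q, 0 < w (of q)
  proportional : ∀ u : GrothendieckAddGroup Q →+ ℤ, (∀ q : Q, w (of q) = 0 → u (of q) = 0) →
    ∀ x y, w x * u y = u x * w y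

/-- The prime ideal of the elements at which a functional is positive. -/
def primeOfNonneg (w : GrothendieckAddGroup Q →+ ℤ) (hw : ∀ q : Q, 0 ≤ w (of q)) :
    MonoidSpec Q where
  val :=
    { carrier := {q | 0 < w (of q)}
      vadd_mem' := fun c x hx => by
        have hx : 0 < w (of x) := hx
        have : 0 < w (of (c + x)) := by
          rw [map_add, map_add]; exact add_pos_of_nonneg_of_pos (hw c) hx
        exact this }
  property :=
    { ne_univ := fun h => by
        have h0 : 0 < w (of (0 : Q)) := h.ge (Set.mem_univ (0 : Q))
        rw [map_zero, map_zero] at h0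
        exact h0.false
      mem_or_mem := fun {q k} h => by
        have h : 0 < w (of (q + k)) := h
        rw [map_add, map_add] at h
        by_contra! hc
        have h1 : ¬ 0 < w (of q) := hc.1
        have h2 : ¬ 0 < w (of k) := hc.2
        lia }

/-- Farkas' lemma with a facet for the localization of a fine monoid at a face. -/
theorem exists_facet_at_prime [AddMonoid.FG Q] (p : MonoidSpec Q) {x : GrothendieckAddGroup Q}
    (hx : ∀ n : ℕ, 0 < n → ∀ s f : Q, f ∉ p.1 → n • x ≠ of s - of f) :
    ∃ w : GrothendieckAddGroup Q →+ ℤ, IsFacetFunctional w ∧ w x < 0 ∧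
      ∀ q, q ∉ p.1 → w (of q) = 0 := by
  classical
  obtain ⟨T, hT⟩ := AddMonoid.fg_def.1 (inferInstance : AddMonoid.FG Q)
  have hTq : ∀ q, q ∈ AddSubmonoid.closure (T : Set Q) := fun q => hT ▸ AddSubmonoid.mem_top q
  -- Generators of the localization at the face `Q \ p`; nonnegativity on them forces vanishing on
  -- that face.
  let T' : Finset (GrothendieckAddGroup Q) :=
    T.image of ∪ ({t ∈ T | t ∉ p.1} : Finset Q).image fun t => -of t
  have hT'top : AddSubgroup.closure (T' : Set (GrothendieckAddGroup Q)) = ⊤ :=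
    top_le_iff.1 ((closure_image_of hT).ge.trans
      (AddSubgroup.closure_mono (Finset.coe_subset.2 Finset.subset_union_left)))
  have hpos : ∀ t ∈ T, of t ∈ T' := fun t ht =>
    Finset.mem_union_left _ (Finset.mem_image_of_mem _ ht)
  have hneg : ∀ t ∈ T, t ∉ p.1 → -of t ∈ T' := fun t ht htp =>
    Finset.mem_union_right _ (Finset.mem_image.2 ⟨t, by simp [ht, htp], rfl⟩)
  have hcl : ∀ y ∈ AddSubmonoid.closure (T' : Set (GrothendieckAddGroup Q)),
      ∃ s f : Q, f ∉ p.1 ∧ y = of s - of f := by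
    intro y hy
    induction hy using AddSubmonoid.closure_induction with
    | mem y hy =>
      rcases Finset.mem_union.1 (Finset.mem_coe.1 hy) with hy | hy
      · obtain ⟨t, ht, rfl⟩ := Finset.mem_image.1 hy
        exact ⟨t, 0, p.2.zero_notMem, by rw [map_zero, sub_zero]⟩
      · obtain ⟨t, ht, rfl⟩ := Finset.mem_image.1 hy
        exact ⟨0, t, (Finset.mem_filter.1 ht).2, by rw [map_zero, zero_sub]⟩
    | zero => exact ⟨0, 0, p.2.zero_notMem, by rw [sub_self]⟩
    | add y z _ _ hy hz =>
      obtain ⟨s, f, hf, rfl⟩ := hy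
      obtain ⟨s', f', hf', rfl⟩ := hz
      exact ⟨s + s', f + f', fun h => (p.2.mem_or_mem h).elim hf hf', by
        rw [map_add, map_add, sub_add_sub_comm]⟩
  obtain ⟨w, hw, hwx, hprop⟩ := exists_facet_neg T' hT'top (x := x) fun n hn h => by
    obtain ⟨s, f, hf, h⟩ := hcl _ h
    exact hx n hn s f hf h
  have hnonneg : ∀ q : Q, 0 ≤ w (of q) := by
    intro q
    induction hTq q using AddSubmonoid.closure_induction with
    | mem t ht => exact hw _ (hpos t ht)
    | zero => rw [map_zero, map_zero]
    | add a b _ _ ha hb => rw [map_add, map_add]; exact add_nonneg ha hb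
  refine ⟨w, ⟨hnonneg, ?_, fun u hu y z => ?_⟩, hwx, fun q => ?_⟩
  · obtain ⟨a, b, hab⟩ := exists_eq_of_sub_of x
    refine ⟨b, ?_⟩
    rw [hab, map_sub] at hwx
    have := hnonneg a
    lia
  · have hu' : ∀ g ∈ T', w g = 0 → u g = 0 := by
      intro g hg
      rcases Finset.mem_union.1 hg with hg | hg
      · obtain ⟨t, ht, rfl⟩ := Finset.mem_image.1 hg
        exact hu t
      · obtain ⟨t, ht, rfl⟩ := Finset.mem_image.1 hg
        rw [map_neg, map_neg, neg_eq_zero, neg_eq_zero]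
        exact hu t
    have hy := hprop u hu' y
    have hz := hprop u hu' z
    refine mul_left_cancel₀ hwx.ne ?_
    linear_combination w y * hz - w z * hy
  · induction hTq q using AddSubmonoid.closure_induction with
    | mem t ht =>
      intro htp
      have := hw _ (hneg t ht htp)
      rw [map_neg] at this
      have := hnonneg t
      lia
    | zero => simp
    | add a b _ _ ha hb =>
      intro h
      rw [map_add, map_add, ha fun h' => h (IsPrimeIdeal.add_mem' b h'),
        hb fun h' => h (IsPrimeIdeal.add_mem a h'), add_zero]

/-- No positive multiple of -a lies in the localization at the complement of `p`: n(-a) = s - f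
would give f = s + n a ∈ p. -/
theorem exists_facet_pos [IsCancelAdd Q] [AddMonoid.FG Q] (p : MonoidSpec Q) {a : Q}
    (ha : a ∈ p.1) : ∃ w : GrothendieckAddGroup Q →+ ℤ, IsFacetFunctional w ∧ 0 < w (of a) ∧
      ∀ q, q ∉ p.1 → w (of q) = 0 := by
  obtain ⟨w, hw, hwa, hwp⟩ := exists_facet_at_prime p (x := -of a) fun n hn s f hf h => by
    have h1 : of f = of (s + n • a) := by
      rw [map_add, map_nsmul]
      rw [smul_neg, neg_eq_iff_eq_neg, neg_sub] at h
      rw [h, add_sub_cancel]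
    have h2 := GrothendieckAddGroup.of_injective h1
    refine hf (h2 ▸ IsPrimeIdeal.add_mem s ?_)
    obtain ⟨m, rfl⟩ := Nat.exists_eq_succ_of_ne_zero hn.ne'
    rw [Nat.succ_eq_add_one, succ_nsmul]
    exact IsPrimeIdeal.add_mem _ ha
  exact ⟨w, hw, by simpa using hwa, hwp⟩

theorem IsFacetFunctional.height_eq_one [IsCancelAdd Q] [AddMonoid.FG Q]
    {w : GrothendieckAddGroup Q →+ ℤ} (hw : IsFacetFunctional w) :
    Order.height (primeOfNonneg w hw.nonneg) = 1 := by
  refine (height_eq_one_iff _).2 ⟨hw.exists_pos, fun p' ⟨a, ha⟩ hle => le_antisymm hle ?_⟩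
  intro q hq
  by_contra hqp
  obtain ⟨w', -, hwa, hwp⟩ := exists_facet_pos p' ha
  -- `w'` vanishes off `p'`, hence wherever `w` does, so it is proportional to `w`; yet it is zero
  -- at `q` and positive at `a`.
  have h1 := hw.proportional w' (fun r hr => hwp r fun h => by
    have : 0 < w (of r) := hle h
    lia) (of q) (of a)
  rw [hwp q hqp, zero_mul] at h1
  exact (mul_pos hq hwa).ne' h1

/-- The functional cutting out a prime ideal of height one. -/
theorem exists_facet_of_height_one [IsCancelAdd Q] [AddMonoid.FG Q] (p : HeightOnePrime Q) :
    ∃ w : GrothendieckAddGroup Q →+ ℤ, IsFacetFunctional w ∧ ∀ q, 0 < w (of q) ↔ q ∈ p.1.1 := by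
  obtain ⟨⟨a, ha⟩, hmin⟩ := (height_eq_one_iff _).1 p.2
  obtain ⟨w, hw, -, hwp⟩ := exists_facet_pos p.1 ha
  refine ⟨w, hw, fun q => ?_⟩
  rw [← hmin (primeOfNonneg w hw.nonneg) hw.exists_pos fun q hq => by
    by_contra h
    have : 0 < w (of q) := hq
    rw [hwp q h] at this
    exact this.false]
  rfl

theorem IsFacetFunctional.exists_isValuationAt [IsCancelAdd Q] [AddMonoid.FG Q]
    {w : GrothendieckAddGroup Q →+ ℤ} (hw : IsFacetFunctional w) (p : HeightOnePrime Q)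
    (hp : ∀ q, 0 < w (of q) ↔ q ∈ p.1.1) :
    ∃ (w' : GrothendieckAddGroup Q →+ ℤ) (d : ℤ), 0 < d ∧ IsValuationAt p w' ∧
      ∀ y, w y = d * w' y := by
  obtain ⟨w', d, hd, hsurj, h⟩ := exists_surjective_of_ne_zero (w := w) (by
    rintro rfl
    obtain ⟨q, hq⟩ := hw.exists_pos
    exact hq.false)
  refine ⟨w', d, hd, ⟨hsurj, fun q => ?_⟩, h⟩
  rw [← hp q, h, mul_pos_iff_of_pos_left hd]

theorem IsValuationAt.eq_zero {p : HeightOnePrime Q} {w : GrothendieckAddGroup Q →+ ℤ}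
    (hw : IsValuationAt p w) {f : Q} (hf : f ∉ p.1.1) : w (of f) = 0 := by
  obtain ⟨⟨a, ha⟩, -⟩ := (height_eq_one_iff _).1 p.2
  have h0 : w (of f) ≤ 0 := not_lt.1 fun h => hf ((hw.pos_iff f).1 h)
  by_contra hne
  -- If w(f) ≤ -1, adding w(a) copies of `f` to `a` makes the value nonpositive, although the sum
  -- stays in the prime.
  have h1 := (hw.pos_iff (a + (w (of a)).toNat • f)).2 (IsPrimeIdeal.add_mem' _ ha)
  have h2 := (hw.pos_iff a).2 ha
  rw [map_add, map_add, map_nsmul, map_nsmul, nsmul_eq_mul, Int.toNat_of_nonneg h2.le] at h1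
  nlinarith [mul_nonneg h2.le (show 0 ≤ -1 - w (of f) by lia)]

theorem IsValuationAt.nonneg {p : HeightOnePrime Q} {w : GrothendieckAddGroup Q →+ ℤ}
    (hw : IsValuationAt p w) (q : Q) : 0 ≤ w (of q) := by
  by_cases hq : q ∈ p.1.1
  · exact ((hw.pos_iff q).2 hq).le
  · exact (hw.eq_zero hq).ge

theorem IsFacetFunctional.exists_eq_mul {w : GrothendieckAddGroup Q →+ ℤ}
    (hw : IsFacetFunctional w) {p : HeightOnePrime Q} (hp : ∀ q, 0 < w (of q) ↔ q ∈ p.1.1)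
    {u : GrothendieckAddGroup Q →+ ℤ} (hu : IsValuationAt p u) :
    ∃ d : ℤ, 0 < d ∧ ∀ y, w y = d * u y := by
  obtain ⟨z, hz⟩ := hu.surjective 1
  have h : ∀ y, w y = w z * u y := fun y => by
    rw [hw.proportional u (fun q hq => hu.eq_zero fun h => ((hp q).2 h).ne' hq) z y, hz, one_mul]
  obtain ⟨a, ha⟩ := hw.exists_pos
  refine ⟨w z, pos_of_mul_pos_left (b := u (of a)) (h (of a) ▸ ha) (hu.nonneg a), h⟩

theorem IsValuationAt.unique [IsCancelAdd Q] [AddMonoid.FG Q] {p : HeightOnePrime Q}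
    {w₁ w₂ : GrothendieckAddGroup Q →+ ℤ} (h₁ : IsValuationAt p w₁) (h₂ : IsValuationAt p w₂) :
    w₁ = w₂ := by
  obtain ⟨w, hw, hp⟩ := exists_facet_of_height_one p
  obtain ⟨d₁, hd₁, h₁'⟩ := hw.exists_eq_mul hp h₁
  obtain ⟨d₂, hd₂, h₂'⟩ := hw.exists_eq_mul hp h₂
  obtain ⟨y₁, hy₁⟩ := h₁.surjective 1
  obtain ⟨y₂, hy₂⟩ := h₂.surjective 1
  -- By surjectivity, each of d₁ and d₂ is a value of the common functional `w`, hence a multiple of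
  -- the other.
  have h12 : d₂ ∣ d₁ := ⟨w₂ y₁, by rw [← h₂', h₁', hy₁, mul_one]⟩
  have h21 : d₁ ∣ d₂ := ⟨w₁ y₂, by rw [← h₁', h₂', hy₂, mul_one]⟩
  obtain rfl := Int.dvd_antisymm hd₁.le hd₂.le h21 h12
  exact AddMonoidHom.ext fun y => mul_left_cancel₀ hd₁.ne' (by rw [← h₁', ← h₂'])

theorem isValuationAt_valuation [IsCancelAdd Q] [AddMonoid.FG Q] (p : HeightOnePrime Q) :
    IsValuationAt p (valuation p) := by
  obtain ⟨w, hw, hp⟩ := exists_facet_of_height_one p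
  obtain ⟨w', -, -, hw', -⟩ := hw.exists_isValuationAt p hp
  exact Classical.epsilon_spec (p := IsValuationAt p) ⟨w', hw'⟩

theorem isValuationAt_iff [IsCancelAdd Q] [AddMonoid.FG Q] (p : HeightOnePrime Q)
    (w : GrothendieckAddGroup Q →+ ℤ) : IsValuationAt p w ↔ w = valuation p :=
  ⟨fun h => h.unique (isValuationAt_valuation p), fun h => h ▸ isValuationAt_valuation p⟩

/-- The valuations at the prime ideals of height one cut out the saturation of `Q` in `Q^gp`. -/
theorem exists_nsmul_mem_range_of_valuation_nonneg [IsCancelAdd Q] [AddMonoid.FG Q]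
    {x : GrothendieckAddGroup Q} (hx : ∀ p : HeightOnePrime Q, 0 ≤ valuation p x) :
    ∃ n : ℕ, 0 < n ∧ n • x ∈ Set.range (of (M := Q)) := by
  by_contra! hx'
  -- The complement of this prime consists of units, so localizing there changes nothing.
  obtain ⟨w, hw, hwx, -⟩ := exists_facet_at_prime (nonunitPrime Q) (x := x) fun n hn s f hf h => by
    obtain ⟨g, hg⟩ := isAddUnit_iff_exists_neg.1 (not_not.1 (mem_nonunitPrime.not.1 hf))
    refine hx' n hn ⟨s + g, ?_⟩
    rw [h, map_add, eq_sub_iff_add_eq, add_assoc, ← map_add of g f, add_comm g f, hg, map_zero,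
      add_zero]
  let p : HeightOnePrime Q := ⟨_, hw.height_eq_one⟩
  obtain ⟨w', d, hd, hw', h⟩ := hw.exists_isValuationAt p fun q => Iff.rfl
  rw [h, (isValuationAt_iff p w').1 hw'] at hwx
  exact (mul_nonneg hd.le (hx p)).not_gt hwx

theorem finite_monoidSpec [AddMonoid.FG Q] : Finite (MonoidSpec Q) := by
  obtain ⟨T, hT⟩ := AddMonoid.fg_def.1 (inferInstance : AddMonoid.FG Q)
  -- A prime contains a sum iff it contains a summand, so it is determined by the generators it
  -- contains.
  have hinj : Function.Injective fun (p : MonoidSpec Q) (t : T) => (t : Q) ∈ p.1 := by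
    intro p p' h
    have h : ∀ t ∈ T, t ∈ p.1 ↔ t ∈ p'.1 := fun t ht => iff_of_eq (congrFun h ⟨t, ht⟩)
    refine Subtype.ext (SetLike.ext fun q => ?_)
    have hq : q ∈ AddSubmonoid.closure (T : Set Q) := hT ▸ AddSubmonoid.mem_top q
    have hadd : ∀ (p : MonoidSpec Q) (a b : Q), a + b ∈ p.1 ↔ a ∈ p.1 ∨ b ∈ p.1 := fun p a b =>
      ⟨fun h => p.2.mem_or_mem h, fun h => h.elim (IsPrimeIdeal.add_mem' b)
        (IsPrimeIdeal.add_mem a)⟩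
    induction hq using AddSubmonoid.closure_induction with
    | mem t ht => exact h t ht
    | zero => exact iff_of_false p.2.zero_notMem p'.2.zero_notMem
    | add a b _ _ ha hb => exact (hadd p a b).trans ((or_congr ha hb).trans (hadd p' a b).symm)
  exact Finite.of_injective _ hinj

end Facets

/-! ### The total valuation: locality, fibres, exactness. -/

section Valuation

open GrothendieckAddGroup (of)

variable {Q : Type*} [AddCommMonoid Q] [IsCancelAdd Q] [AddMonoid.FG Q]

instance finite_heightOnePrime : Finite (HeightOnePrime Q) :=
  have := finite_monoidSpec (Q := Q)
  inferInstance

variable (Q) in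
/-- The homomorphism `v = ∑ v_𝔭 𝔭` from `Q` to the free monoid on its prime ideals of height one. -/
noncomputable def totalValuation : Q →+ (HeightOnePrime Q →₀ ℕ) where
  toFun q := Finsupp.equivFunOnFinite.symm fun p => (valuation p (of q)).toNat
  map_zero' := by
    ext p
    simp
  map_add' a b := by
    ext p
    simp only [Finsupp.equivFunOnFinite_symm_apply_apply, Finsupp.add_apply, map_add]
    exact Int.toNat_add ((isValuationAt_valuation p).nonneg a) ((isValuationAt_valuation p).nonneg b)

theorem totalValuation_apply (q : Q) (p : HeightOnePrime Q) :
    ((totalValuation Q q p : ℕ) : ℤ) = valuation p (of q) :=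
  Int.toNat_of_nonneg ((isValuationAt_valuation p).nonneg q)

theorem totalValuation_eq_iff {q₁ q₂ : Q} : totalValuation Q q₁ = totalValuation Q q₂ ↔
    ∀ p : HeightOnePrime Q, valuation p (of q₁) = valuation p (of q₂) := by
  rw [DFunLike.ext_iff]
  refine forall_congr' fun p => ?_
  rw [← totalValuation_apply, ← totalValuation_apply, Nat.cast_inj]

theorem isAddUnit_of_valuation_eq_zero {q : Q}
    (hq : ∀ p : HeightOnePrime Q, valuation p (of q) = 0) : IsAddUnit q := by
  obtain ⟨n, hn, a, ha⟩ := exists_nsmul_mem_range_of_valuation_nonneg (x := -of q)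
    fun p => by rw [map_neg, hq p, neg_zero]
  have h : n • q + a = 0 := GrothendieckAddGroup.of_injective (by
    rw [map_add, ha, map_nsmul, smul_neg, add_neg_cancel, map_zero])
  obtain ⟨m, rfl⟩ := Nat.exists_eq_succ_of_ne_zero hn.ne'
  rw [Nat.succ_eq_add_one, succ_nsmul', add_assoc] at h
  exact isAddUnit_iff_exists_neg.2 ⟨_, h⟩

theorem valuation_eq_zero_of_isAddUnit {q : Q} (hq : IsAddUnit q) (p : HeightOnePrime Q) :
    valuation p (of q) = 0 := by
  obtain ⟨a, ha⟩ := isAddUnit_iff_exists_neg.1 hq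
  have h : valuation p (of (q + a)) = 0 := by rw [ha, map_zero, map_zero]
  rw [map_add, map_add] at h
  have := (isValuationAt_valuation p).nonneg q
  have := (isValuationAt_valuation p).nonneg a
  lia

theorem isLocal_totalValuation : IsLocal (totalValuation Q) := by
  ext q
  have h : IsAddUnit (totalValuation Q q) ↔ totalValuation Q q = totalValuation Q 0 := by
    rw [map_zero]
    exact isAddUnit_iff_eq_zero
  rw [Set.mem_preimage, Set.mem_ofPred_eq, Set.mem_ofPred_eq, h, totalValuation_eq_iff]
  simp only [map_zero]
  exact ⟨isAddUnit_of_valuation_eq_zero, valuation_eq_zero_of_isAddUnit⟩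

theorem toSharpQuotient_eq_iff {M : Type*} [AddCommMonoid M] {a b : M} :
    toSharpQuotient M a = toSharpQuotient M b ↔
      ∃ u, IsAddUnit u ∧ ∃ u', IsAddUnit u' ∧ a + u = b + u' :=
  (quotientCon (IsAddUnit.addSubmonoid M)).eq

theorem totalValuation_eq_iff_toSharpQuotient {q₁ q₂ : Q} :
    totalValuation Q q₁ = totalValuation Q q₂ ↔
      ∃ n : ℕ, 0 < n ∧ n • toSharpQuotient Q q₁ = n • toSharpQuotient Q q₂ := by
  simp only [totalValuation_eq_iff, ← map_nsmul, toSharpQuotient_eq_iff]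
  constructor
  · intro h
    obtain ⟨n, hn, a, ha⟩ := exists_nsmul_mem_range_of_valuation_nonneg (x := of q₁ - of q₂)
      fun p => by rw [map_sub, h p, sub_self]
    -- The element `a` representing n(q₁ - q₂) has all valuations zero, so it is the required unit.
    refine ⟨n, hn, 0, isAddUnit_zero, a, isAddUnit_of_valuation_eq_zero fun p => ?_,
      GrothendieckAddGroup.of_injective ?_⟩
    · rw [ha, map_nsmul, map_sub, h p, sub_self, smul_zero]
    · rw [add_zero, map_add, ha, map_nsmul, map_nsmul, smul_sub, add_sub_cancel]
  · rintro ⟨n, hn, u, hu, u', hu', h⟩ p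
    have h' := congrArg (fun x => valuation p (of x)) h
    simp only [map_add, map_nsmul, valuation_eq_zero_of_isAddUnit hu p,
      valuation_eq_zero_of_isAddUnit hu' p, add_zero] at h'
    exact nsmul_right_injective hn.ne' h'

/-- Evaluation at `p` on the group completion of the free monoid. -/
noncomputable def evalGp (p : HeightOnePrime Q) :
    GrothendieckAddGroup (HeightOnePrime Q →₀ ℕ) →+ ℤ :=
  GrothendieckAddGroup.lift ((Nat.castAddMonoidHom ℤ).comp (Finsupp.applyAddHom p))

theorem lift_of {M G : Type*} [AddCommMonoid M] [AddCommGroup G] (f : M →+ G) (m : M) :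
    GrothendieckAddGroup.lift f (of m) = f m :=
  DFunLike.congr_fun (GrothendieckAddGroup.lift.symm_apply_apply f) m

theorem gpMap_of {M N : Type*} [AddCommMonoid M] [AddCommMonoid N] (f : M →+ N) (m : M) :
    gpMap f (of m) = of (f m) :=
  lift_of _ m

theorem evalGp_gpMap (p : HeightOnePrime Q) (x : GrothendieckAddGroup Q) :
    evalGp p (gpMap (totalValuation Q) x) = valuation p x := by
  obtain ⟨a, b, rfl⟩ := exists_eq_of_sub_of x
  have h : ∀ q : Q, evalGp p (gpMap (totalValuation Q) (of q)) = valuation p (of q) := fun q => by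
    rw [gpMap_of, ← totalValuation_apply]
    exact lift_of _ _
  rw [map_sub, map_sub, map_sub, h, h]

/-- Coordinates separate the group completion of the free monoid, so exactness becomes a statement
about the numbers v_𝔭(x). -/
theorem of_eq_gpMap_iff {w : HeightOnePrime Q →₀ ℕ} {x : GrothendieckAddGroup Q} :
    of w = gpMap (totalValuation Q) x ↔ ∀ p, (w p : ℤ) = valuation p x := by
  constructor
  · intro h p
    rw [← evalGp_gpMap, ← h]
    exact (lift_of ((Nat.castAddMonoidHom ℤ).comp (Finsupp.applyAddHom p)) w).symm
  · intro h
    obtain ⟨a, b, rfl⟩ := exists_eq_of_sub_of x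
    rw [map_sub, gpMap_of, gpMap_of, eq_sub_iff_add_eq, ← map_add]
    congr 1
    ext p
    have := h p
    rw [map_sub, ← totalValuation_apply, ← totalValuation_apply] at this
    rw [Finsupp.add_apply]
    lia

theorem isExact_totalValuation_iff : IsExact (totalValuation Q) ↔ IsSaturated Q := by
  constructor
  · refine fun h => ⟨inferInstance, fun x m hm ⟨q, hq⟩ => ?_⟩
    have hx : ∀ p : HeightOnePrime Q, 0 ≤ valuation p x := fun p => by
      have h1 := (isValuationAt_valuation p).nonneg q
      rw [hq, map_nsmul] at h1
      exact (nsmul_nonneg_iff hm.ne').1 h1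
    obtain ⟨r, ⟨-, hr⟩, -⟩ := h
      (Finsupp.equivFunOnFinite.symm fun p => (valuation p x).toNat) x
      (of_eq_gpMap_iff.2 fun p => Int.toNat_of_nonneg (hx p))
    exact ⟨r, hr⟩
  · intro h w x hwx
    rw [of_eq_gpMap_iff] at hwx
    obtain ⟨n, hn, hnx⟩ := exists_nsmul_mem_range_of_valuation_nonneg (x := x)
      fun p => hwx p ▸ Nat.cast_nonneg _
    obtain ⟨r, rfl⟩ := h.mem_of_nsmul_mem x n hn hnx
    refine ⟨r, ⟨?_, rfl⟩, fun r' hr' => GrothendieckAddGroup.of_injective hr'.2⟩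
    ext p
    have := hwx p
    rw [← totalValuation_apply] at this
    exact_mod_cast this.symm

end Valuation
end CommMonoidGeometry

theorem mainTheorem9 (Q : Type*) [AddCommMonoid Q] [IsCancelAdd Q] [AddMonoid.FG Q] :
    Finite (CommMonoidGeometry.HeightOnePrime Q) ∧
    (∀ (p : CommMonoidGeometry.HeightOnePrime Q) (w : GrothendieckAddGroup Q →+ ℤ),
      CommMonoidGeometry.IsValuationAt p w ↔ w = CommMonoidGeometry.valuation p) ∧
    ∃ v : Q →+ (CommMonoidGeometry.HeightOnePrime Q →₀ ℕ),
      (∀ (q : Q) (p : CommMonoidGeometry.HeightOnePrime Q),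
        ((v q p : ℕ) : ℤ) = CommMonoidGeometry.valuation p (GrothendieckAddGroup.of q)) ∧
      CommMonoidGeometry.IsLocal v ∧
      (∀ q₁ q₂ : Q, v q₁ = v q₂ ↔
        ∃ n : ℕ, 0 < n ∧
          n • CommMonoidGeometry.toSharpQuotient Q q₁ =
            n • CommMonoidGeometry.toSharpQuotient Q q₂) ∧
      (CommMonoidGeometry.IsExact v ↔ CommMonoidGeometry.IsSaturated Q) :=
  ⟨inferInstance, CommMonoidGeometry.isValuationAt_iff,
    CommMonoidGeometry.totalValuation Q, CommMonoidGeometry.totalValuation_apply,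
    CommMonoidGeometry.isLocal_totalValuation,
    fun _ _ => CommMonoidGeometry.totalValuation_eq_iff_toSharpQuotient,
    CommMonoidGeometry.isExact_totalValuation_iff⟩
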